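/- All vector spaces are real. A smooth manifold is finite-dimensional, Hausdorff, second-countable and without boundary; it carries its standard diffeology, whose plots are the smooth maps (in the usual sense) from open subsets of Euclidean spaces to $M$. For a diffeological space $X$, let $D(X)$ be the set $X$ with the $D$-topology, i.e. the finest topology for which every plot of $X$ is continuous; products of diffeological spaces carry the product diffeology. Let $F(X)$ be the free diffeological vector space generated by $X$: as a vector space $F(X)=\bigoplus_{x\in X}\mathbb{R}$, with basis elements $[x]$, $x\in X$, equipped with the diffeology generated by the maps $$\rho_n:(\mathbb{R}\times X)^n\to F(X),\qquad (r_1,x_1,\dots,r_n,x_n)\mapsto \sum_{i=1}^n r_i[x_i],\qquad n\ge 1$$ (the smallest diffeology on $F(X)$ for which every $\rho_n$ is smooth). Then for every smooth manifold $M$, the $D$-topology makes $F(M)$ a topological vector space (addition $D(F(M))\times D(F(M))\to D(F(M))$ and scalar multiplication $\mathbb{R}\times D(F(M))\to D(F(M))$ are continuous), and $D(F(M)\times F(M)) = D(F(M))\times D(F(M))$, i.e. the $D$-topology of the product diffeology on $F(M)\times F(M)$ is the product of the $D$-topologies. -/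

import Mathlib

open Diffeology
open scoped Manifold ContDiff

noncomputable section

/-- The standard diffeology of a smooth manifold: the plots are the maps out of Euclidean space
that are smooth in the usual sense. -/
abbrev manifoldDiffeology {E H : Type*} [NormedAddCommGroup E] [NormedSpace ℝ E]
    [TopologicalSpace H] (I : ModelWithCorners ℝ E H) (M : Type*) [TopologicalSpace M]
    [ChartedSpace H M] : DiffeologicalSpace M :=
  .ofCorePlotsOn {
    isPlotOn := fun {n u} _ p ↦ ContMDiffOn (𝓡 n) I ∞ p u
    isPlotOn_congr := fun _ _ _ h ↦ contMDiffOn_congr fun x hx ↦ h hx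
    isPlot := fun {n} p ↦ ContMDiff (𝓡 n) I ∞ p
    isPlotOn_univ := contMDiffOn_univ
    isPlot_const := fun _ ↦ contMDiff_const
    isPlotOn_reparam := fun _ _ _ h hp hf ↦ hp.comp hf.contMDiffOn h
    locality := fun _ _ h ↦ fun x hxu ↦ by
      obtain ⟨v, hv, hxv, hv'⟩ := h x hxu
      exact ((hv' x hxv).contMDiffAt (hv.mem_nhds hxv)).contMDiffWithinAt }

/-- The product diffeology: a map into `X × Y` is a plot iff both components are plots. -/
instance prodDiffeology {X Y : Type*} [DiffeologicalSpace X] [DiffeologicalSpace Y] :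
    DiffeologicalSpace (X × Y) where
  plots _ := {p | IsPlot (fun u ↦ (p u).1) ∧ IsPlot (fun u ↦ (p u).2)}
  constant_plots _ := ⟨isPlot_const, isPlot_const⟩
  plot_reparam hp hf := ⟨isPlot_reparam hp.1 hf, isPlot_reparam hp.2 hf⟩
  locality hp := by
    refine ⟨DiffeologicalSpace.locality fun x ↦ ?_, DiffeologicalSpace.locality fun x ↦ ?_⟩
    · obtain ⟨u, hu, hx, h⟩ := hp x
      exact ⟨u, hu, hx, fun hfu hf ↦ (h hfu hf).1⟩
    · obtain ⟨u, hu, hx, h⟩ := hp x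
      exact ⟨u, hu, hx, fun hfu hf ↦ (h hfu hf).2⟩

/-- The product diffeology: a map into `∀ i, X i` is a plot iff all components are plots. -/
instance piDiffeology {ι : Type*} {X : ι → Type*} [∀ i, DiffeologicalSpace (X i)] :
    DiffeologicalSpace (∀ i, X i) where
  plots _ := {p | ∀ i, IsPlot (fun u ↦ p u i)}
  constant_plots _ := fun _ ↦ isPlot_const
  plot_reparam hp hf := fun i ↦ isPlot_reparam (hp i) hf
  locality hp := fun i ↦ DiffeologicalSpace.locality fun x ↦ by
    obtain ⟨u, hu, hx, h⟩ := hp x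
    exact ⟨u, hu, hx, fun hfu hf ↦ h hfu hf i⟩

/-- The vector space `F(X) = ⨁_{x ∈ X} ℝ` underlying the free diffeological vector space. -/
def FreeDVS (X : Type*) : Type _ := X →₀ ℝ

instance (X : Type*) : AddCommGroup (FreeDVS X) := inferInstanceAs (AddCommGroup (X →₀ ℝ))

instance (X : Type*) : Module ℝ (FreeDVS X) := inferInstanceAs (Module ℝ (X →₀ ℝ))

/-- The basis element `[x]` of `F(X)`. -/
def FreeDVS.basisElem {X : Type*} (x : X) : FreeDVS X := Finsupp.single x (1 : ℝ)

/-- The map `ρ_n : (ℝ × X)^n → F(X)`, `(r₁, x₁, …, rₙ, xₙ) ↦ ∑ rᵢ [xᵢ]`. -/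
def FreeDVS.rho {X : Type*} (n : ℕ) (v : Fin n → ℝ × X) : FreeDVS X :=
  ∑ i, (v i).1 • FreeDVS.basisElem (v i).2

/-- The diffeology of the free diffeological vector space `F(X)`: it is generated by the maps
`ρ_n`, `n > 0`, that is, by the composites of the `ρ_n` with the plots of `(ℝ × X)^n`. -/
instance FreeDVS.diffeology (X : Type*) [DiffeologicalSpace X] :
    DiffeologicalSpace (FreeDVS X) :=
  DiffeologicalSpace.generateFrom
    {p | ∃ n : ℕ, 0 < n ∧ ∃ (m : ℕ) (q : EuclideanSpace ℝ (Fin m) → (Fin n → ℝ × X)),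
      IsPlot q ∧ p = ⟨m, FreeDVS.rho n ∘ q⟩}

/-- The `D`-topology makes `V` a (not necessarily Hausdorff) real topological vector space. -/
def IsTVSUnderDTopology (V : Type*) [AddCommGroup V] [Module ℝ V] [DiffeologicalSpace V] : Prop :=
  letI : TopologicalSpace V := dTopology
  IsTopologicalAddGroup V ∧ ContinuousSMul ℝ V

end

/-! The `D`-topology of `M`, and of each `(ℝ × M)^n`, is the usual one, so `F(M)` is a topological
quotient of the disjoint union of these spaces by the maps `ρ_n`. Addition lifts to concatenation of
tuples, which is continuous; what has to be shown is that the square of this quotient map is again a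
quotient map, which fails for general quotient maps. It holds here
(`IsQuotientMap.prodMap_of_sigmaCompact`) because the disjoint union is locally compact and
`σ`-compact and `F(M)` is Hausdorff: linear extensions of continuous functions on `M` separate its
points. The same fact identifies the two topologies on `F(M) × F(M)`. -/

open Set Topology

/-! ### Products of quotient maps -/

section QuotientMaps

variable {A B X Y : Type*} [TopologicalSpace A] [TopologicalSpace B] [TopologicalSpace X]
  [TopologicalSpace Y]

/-- In a Hausdorff space, a compact subset of a compact set `P` which lies in an open set `U` has a
compact neighbourhood relative to `P` that is contained in `U`. -/
theorem IsCompact.exists_isCompact_relative_nhds [T2Space X] {C P U : Set X} (hC : IsCompact C)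
    (hP : IsCompact P) (hU : IsOpen U) (hCU : C ⊆ U) :
    ∃ C' O : Set X, IsCompact C' ∧ C' ⊆ P ∧ C' ⊆ U ∧ IsOpen O ∧ C ⊆ O ∧ O ∩ P ⊆ C' := by
  have hd : Disjoint C (P \ U) := disjoint_left.2 fun x hx hx' ↦ hx'.2 (hCU hx)
  obtain ⟨O, O', hO, hO', hCO, hPO, hOO⟩ := SeparatedNhds.of_isCompact_isCompact hC (hP.diff hU) hd
  refine ⟨P \ O', O, hP.diff hO', sdiff_subset, fun x hx ↦ ?_, hO, hCO, fun x hx ↦ ?_⟩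
  · by_contra h
    exact hx.2 (hPO ⟨hx.1, h⟩)
  · exact ⟨hx.2, disjoint_left.1 hOO hx.1⟩

/-- An increasing union of sets which are relative neighbourhoods of each other along the image of
a compact exhaustion is open in the quotient. -/
theorem Topology.IsQuotientMap.isOpen_iUnion_of_exhaustion {f : A → X} (hf : IsQuotientMap f)
    (K : CompactExhaustion A) {N : ℕ} {C : ℕ → Set X}
    (hC : ∀ n, ∃ O, IsOpen O ∧ C n ⊆ O ∧ O ∩ f '' K (N + n + 1) ⊆ C (n + 1))
    (hmono : Monotone C) : IsOpen (⋃ n, C n) := by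
  rw [← hf.isOpen_preimage, isOpen_iff_mem_nhds]
  intro a ha
  obtain ⟨n, hn⟩ := mem_iUnion.1 ha
  obtain ⟨m, hm⟩ := K.exists_mem a
  -- Index `n` puts `f a` in the union, index `m` puts `a` in the exhaustion; at their maximum, `a`
  -- is interior to the next compact set.
  obtain ⟨O, hO, hCO, hsub⟩ := hC (max n m)
  have ha' : a ∈ interior (K (N + max n m + 1)) :=
    K.subset_interior_succ _ (K.subset (by omega) hm)
  filter_upwards [isOpen_interior.mem_nhds ha',
    (hO.preimage hf.continuous).mem_nhds (hCO (hmono (le_max_left n m) hn))] with b hb hb'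
  exact mem_iUnion.2 ⟨_, hsub ⟨hb', mem_image_of_mem f (interior_subset hb)⟩⟩

/-- The product of two quotient maps from locally compact, `σ`-compact spaces onto Hausdorff spaces
is a quotient map. -/
theorem Topology.IsQuotientMap.prodMap_of_sigmaCompact [WeaklyLocallyCompactSpace A]
    [SigmaCompactSpace A] [WeaklyLocallyCompactSpace B] [SigmaCompactSpace B] [T2Space X]
    [T2Space Y] {f : A → X} {g : B → Y} (hf : IsQuotientMap f) (hg : IsQuotientMap g) :
    IsQuotientMap (Prod.map f g) := by
  have hcont : Continuous (Prod.map f g) := hf.continuous.prodMap hg.continuous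
  refine ⟨isCoinducing_iff.2 fun W ↦ ⟨fun hW ↦ ?_, fun h ↦ h.preimage hcont⟩,
    hf.surjective.prodMap hg.surjective⟩
  rw [isOpen_prod_iff]
  intro a b hab
  let K := CompactExhaustion.choice A
  let L := CompactExhaustion.choice B
  let P (n : ℕ) : Set X := f '' K n
  let Q (n : ℕ) : Set Y := g '' L n
  have hP n : IsCompact (P n) := (K.isCompact n).image hf.continuous
  have hQ n : IsCompact (Q n) := (L.isCompact n).image hg.continuous
  have hPmono : Monotone P := fun m n h ↦ image_mono (K.subset h)
  have hQmono : Monotone Q := fun m n h ↦ image_mono (L.subset h)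
  obtain ⟨a₀, rfl⟩ := hf.surjective a
  obtain ⟨b₀, rfl⟩ := hg.surjective b
  obtain ⟨i, hi⟩ := K.exists_mem a₀
  obtain ⟨j, hj⟩ := L.exists_mem b₀
  let N := max i j
  -- Compact boxes inside `W` are grown one stage at a time, each a neighbourhood of the previous
  -- one relative to the next stage; their union is an open box.
  let Good (n : ℕ) (p : Set X × Set Y) : Prop :=
    IsCompact p.1 ∧ IsCompact p.2 ∧ p.1 ⊆ P (N + n) ∧ p.2 ⊆ Q (N + n) ∧ p.1 ×ˢ p.2 ⊆ W
  have step : ∀ n (p : {p // Good n p}), ∃ q : {q // Good (n + 1) q},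
      (∃ O, IsOpen O ∧ p.1.1 ⊆ O ∧ O ∩ P (N + n + 1) ⊆ q.1.1) ∧
      (∃ O, IsOpen O ∧ p.1.2 ⊆ O ∧ O ∩ Q (N + n + 1) ⊆ q.1.2) := by
    rintro n ⟨⟨C, D⟩, hC, hD, hCP, hDQ, hCD⟩
    -- `W` is not yet known to be open, but its complement within one compact stage is the image of
    -- a compact set, hence closed. The tube lemma is applied to the complement of that image.
    have hZ : IsCompact (Prod.map f g '' ((K (N + n + 1) ×ˢ L (N + n + 1)) \
        (Prod.map f g ⁻¹' W))) :=
      (((K.isCompact _).prod (L.isCompact _)).diff hW).image hcont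
    obtain ⟨U, V, hU, hV, hCU, hDV, hUV⟩ := generalized_tube_lemma hC hD hZ.isClosed.isOpen_compl
      (by
        rintro p hp ⟨q, hq, rfl⟩
        exact hq.2 (hCD hp))
    obtain ⟨C', O, hC', hC'P, hC'U, hO, hCO, hOC⟩ :=
      hC.exists_isCompact_relative_nhds (hP (N + n + 1)) hU hCU
    obtain ⟨D', O', hD', hD'Q, hD'V, hO', hDO, hOD⟩ :=
      hD.exists_isCompact_relative_nhds (hQ (N + n + 1)) hV hDV
    refine ⟨⟨(C', D'), hC', hD', hC'P, hD'Q, ?_⟩, ⟨O, hO, hCO, hOC⟩, ⟨O', hO', hDO, hOD⟩⟩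
    rintro ⟨x, y⟩ ⟨hx, hy⟩
    by_contra hxy
    obtain ⟨k, hk, rfl⟩ := hC'P hx
    obtain ⟨l, hl, rfl⟩ := hD'Q hy
    exact hUV ⟨hC'U hx, hD'V hy⟩ ⟨(k, l), ⟨⟨hk, hl⟩, hxy⟩, rfl⟩
  choose next hnext using step
  have h₀ : Good 0 ({f a₀}, {g b₀}) :=
    ⟨isCompact_singleton, isCompact_singleton,
      singleton_subset_iff.2 ⟨a₀, K.subset (le_max_left i j) hi, rfl⟩,
      singleton_subset_iff.2 ⟨b₀, L.subset (le_max_right i j) hj, rfl⟩, by simpa using hab⟩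
  let s (n : ℕ) : {p // Good n p} := Nat.rec ⟨_, h₀⟩ (fun n p ↦ next n p) n
  have hs n := hnext n (s n)
  have hmono₁ : Monotone fun n ↦ (s n).1.1 := monotone_nat_of_le_succ fun n x hx ↦ by
    obtain ⟨⟨O, -, hCO, hO⟩, -⟩ := hs n
    exact hO ⟨hCO hx, hPmono (Nat.le_succ _) ((s n).2.2.2.1 hx)⟩
  have hmono₂ : Monotone fun n ↦ (s n).1.2 := monotone_nat_of_le_succ fun n x hx ↦ by
    obtain ⟨-, ⟨O, -, hCO, hO⟩⟩ := hs n
    exact hO ⟨hCO hx, hQmono (Nat.le_succ _) ((s n).2.2.2.2.1 hx)⟩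
  refine ⟨⋃ n, (s n).1.1, ⋃ n, (s n).1.2,
    hf.isOpen_iUnion_of_exhaustion K (N := N) (fun n ↦ (hs n).1) hmono₁,
    hg.isOpen_iUnion_of_exhaustion L (N := N) (fun n ↦ (hs n).2) hmono₂,
    mem_iUnion.2 ⟨0, rfl⟩, mem_iUnion.2 ⟨0, rfl⟩, ?_⟩
  rintro ⟨x, y⟩ ⟨hx, hy⟩
  obtain ⟨m, hm⟩ := mem_iUnion.1 hx
  obtain ⟨n, hn⟩ := mem_iUnion.1 hy
  exact (s (max m n)).2.2.2.2.2
    ⟨hmono₁ (le_max_left m n) hm, hmono₂ (le_max_right m n) hn⟩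

theorem continuous_sigma_prod {ι T Z : Type*} [TopologicalSpace Z] {S : ι → Type*}
    [∀ i, TopologicalSpace (S i)] [TopologicalSpace T] {h : (Σ i, S i) × T → Z}
    (hh : ∀ i, Continuous fun p : S i × T ↦ h (⟨i, p.1⟩, p.2)) : Continuous h := by
  rw [continuous_iff_continuousAt]
  rintro ⟨⟨i, a⟩, b⟩
  have he : IsOpenEmbedding (Prod.map (Sigma.mk i) id : S i × T → _) :=
    IsOpenEmbedding.sigmaMk.prodMap .id
  exact (he.continuousAt_iff (g := h) (x := (a, b))).1 (hh i).continuousAt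

theorem continuous_sigma_prod_sigma {ι κ Z : Type*} [TopologicalSpace Z] {S : ι → Type*}
    {T : κ → Type*} [∀ i, TopologicalSpace (S i)] [∀ j, TopologicalSpace (T j)]
    {h : (Σ i, S i) × (Σ j, T j) → Z}
    (hh : ∀ i j, Continuous fun p : S i × T j ↦ h (⟨i, p.1⟩, ⟨j, p.2⟩)) : Continuous h :=
  continuous_sigma_prod fun i ↦
    (continuous_sigma_prod (h := fun p : (Σ j, T j) × S i ↦ h (⟨i, p.2⟩, p.1)) fun j ↦
      (hh i j).comp continuous_swap).comp continuous_swap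

theorem weaklyLocallyCompactSpace_sigma {ι : Type*} {S : ι → Type*} [∀ i, TopologicalSpace (S i)]
    [∀ i, WeaklyLocallyCompactSpace (S i)] : WeaklyLocallyCompactSpace (Σ i, S i) where
  exists_compact_mem_nhds := by
    rintro ⟨i, a⟩
    obtain ⟨K, hK, haK⟩ := exists_compact_mem_nhds a
    exact ⟨_, hK.image continuous_sigmaMk, isOpenMap_sigmaMk.image_mem_nhds haK⟩

end QuotientMaps

/-! ### Spaces whose `D`-topology is the given topology -/

section OpenPlots

/-- Plots are continuous, and the space is covered by images of open plots. -/
structure HasOpenPlots (X : Type*) [TopologicalSpace X] [DiffeologicalSpace X] : Prop where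
  continuous_of_isPlot {n : ℕ} {p : EuclideanSpace ℝ (Fin n) → X} (hp : IsPlot p) : Continuous p
  exists_isPlot (x : X) : ∃ (n : ℕ) (p : EuclideanSpace ℝ (Fin n) → X),
    IsPlot p ∧ IsOpenMap p ∧ x ∈ range p

namespace HasOpenPlots

variable {X Y : Type*} [TopologicalSpace X] [DiffeologicalSpace X] [TopologicalSpace Y]
  [DiffeologicalSpace Y]

/-- A `D`-open set has open preimages under plots, and open plots carry these back to
neighbourhoods. -/
theorem dTopology_eq (hX : HasOpenPlots X) :
    (dTopology : TopologicalSpace X) = ‹TopologicalSpace X› := by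
  refine TopologicalSpace.ext_iff.2 fun U ↦ ⟨fun hU ↦ ?_, fun hU ↦ ?_⟩
  · rw [isOpen_iff_mem_nhds]
    intro x hx
    obtain ⟨n, p, hp, hpo, y, rfl⟩ := hX.exists_isPlot x
    have h := hpo _ (isOpen_iff_preimages_plots.1 hU n p hp)
    exact Filter.mem_of_superset (h.mem_nhds (mem_image_of_mem p hx)) (image_preimage_subset p U)
  · exact isOpen_iff_preimages_plots.2 fun n p hp ↦ hU.preimage (hX.continuous_of_isPlot hp)

theorem continuous_of_dSmooth (hX : HasOpenPlots X) {Z : Type*} [DiffeologicalSpace Z] {f : X → Z}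
    (hf : DSmooth f) : Continuous[_, dTopology] f := by
  have h := hf.continuous
  rwa [hX.dTopology_eq] at h

protected theorem real : HasOpenPlots ℝ where
  continuous_of_isPlot hp := hp.contDiff.continuous
  exists_isPlot x :=
    ⟨_, (toEuclidean (E := ℝ)).symm, (toEuclidean (E := ℝ)).symm.contDiff.isPlot,
      (toEuclidean (E := ℝ)).symm.toHomeomorph.isOpenMap,
      (toEuclidean (E := ℝ)).symm.surjective x⟩

protected theorem prod (hX : HasOpenPlots X) (hY : HasOpenPlots Y) : HasOpenPlots (X × Y) where
  continuous_of_isPlot hp :=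
    (hX.continuous_of_isPlot hp.1).prodMk (hY.continuous_of_isPlot hp.2)
  exists_isPlot := by
    rintro ⟨x, y⟩
    obtain ⟨n, p, hp, hpo, a, rfl⟩ := hX.exists_isPlot x
    obtain ⟨m, q, hq, hqo, b, rfl⟩ := hY.exists_isPlot y
    let e := toEuclidean (E := EuclideanSpace ℝ (Fin n) × EuclideanSpace ℝ (Fin m))
    refine ⟨_, Prod.map p q ∘ e.symm,
      ⟨isPlot_reparam hp (contDiff_fst.comp e.symm.contDiff),
        isPlot_reparam hq (contDiff_snd.comp e.symm.contDiff)⟩,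
      (hpo.prodMap hqo).comp e.symm.toHomeomorph.isOpenMap, e (a, b), ?_⟩
    simp

protected theorem pi {ι : Type*} [Fintype ι] {X : ι → Type*} [∀ i, TopologicalSpace (X i)]
    [∀ i, DiffeologicalSpace (X i)] (hX : ∀ i, HasOpenPlots (X i)) :
    HasOpenPlots (∀ i, X i) where
  continuous_of_isPlot hp := continuous_pi fun i ↦ (hX i).continuous_of_isPlot (hp i)
  exists_isPlot x := by
    choose n p hp hpo a ha using fun i ↦ (hX i).exists_isPlot (x i)
    let e := toEuclidean (E := ∀ i, EuclideanSpace ℝ (Fin (n i)))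
    refine ⟨_, Pi.map p ∘ e.symm,
      fun i ↦ isPlot_reparam (hp i) ((contDiff_pi.1 contDiff_id i).comp e.symm.contDiff),
      (IsOpenMap.piMap hpo (by simp [Filter.cofinite_eq_bot])).comp
        e.symm.toHomeomorph.isOpenMap, e a, ?_⟩
    ext i
    simp [ha]

protected theorem manifold (d : ℕ) (M : Type*) [TopologicalSpace M]
    [ChartedSpace (EuclideanSpace ℝ (Fin d)) M] [IsManifold (𝓡 d) ∞ M] :
    letI : DiffeologicalSpace M := manifoldDiffeology (𝓡 d) M
    HasOpenPlots M := by
  let _ : DiffeologicalSpace M := manifoldDiffeology (𝓡 d) M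
  refine ⟨fun {n p} hp ↦ ContMDiff.continuous (I := 𝓡 n) (I' := 𝓡 d) (n := ∞) hp, fun x ↦ ?_⟩
  let φ := chartAt (EuclideanSpace ℝ (Fin d)) x
  obtain ⟨ε, hε, hball⟩ := Metric.isOpen_iff.1 φ.open_target (φ x) (mem_chart_target _ x)
  -- Plots here are defined on a whole Euclidean space, so that space is first mapped smoothly onto
  -- a ball in the chart's target.
  let b := OpenPartialHomeomorph.univBall (φ x) ε
  have hb (y) : b y ∈ φ.target := hball <| by
    rw [← OpenPartialHomeomorph.univBall_target (φ x) hε]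
    exact b.map_source (by simp [b])
  have hsource : (b.trans φ.symm).source = univ := by
    ext y
    simpa [b] using hb y
  refine ⟨d, b.trans φ.symm, ?_, ((b.trans φ.symm).isOpenEmbedding hsource).isOpenMap, 0, ?_⟩
  · exact (contMDiffOn_chart_symm (I := 𝓡 d) (n := ∞) (x := x)).comp_contMDiff
      OpenPartialHomeomorph.contDiff_univBall.contMDiff hb
  · simp [b, φ]

end HasOpenPlots

end OpenPlots

/-- The diffeology on a topological space whose plots are the continuous maps. -/
abbrev continuousDiffeology (X : Type*) [TopologicalSpace X] : DiffeologicalSpace X :=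
  .ofCorePlotsOn {
    isPlotOn := fun {_ u} _ p ↦ ContinuousOn p u
    isPlotOn_congr := fun _ _ _ h ↦ continuousOn_congr h
    isPlot := fun p ↦ Continuous p
    isPlotOn_univ := continuousOn_univ
    isPlot_const := fun _ ↦ continuous_const
    isPlotOn_reparam := fun _ _ _ h hp hf ↦ hp.comp hf.continuousOn h
    locality := fun _ _ h ↦ fun x hxu ↦ by
      obtain ⟨v, hv, hxv, hv'⟩ := h x hxu
      exact ((hv' x hxv).continuousAt (hv.mem_nhds hxv)).continuousWithinAt }

/-! ### The `D`-topology of the free diffeological vector space -/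

namespace FreeDVS

variable {X : Type*}

theorem rho_append {m n : ℕ} (v : Fin m → ℝ × X) (w : Fin n → ℝ × X) :
    rho (m + n) (Fin.append v w) = rho m v + rho n w := by
  simp [rho, Fin.sum_univ_add]

theorem smul_rho {n : ℕ} (r : ℝ) (v : Fin n → ℝ × X) :
    r • rho n v = rho n fun i ↦ (r * (v i).1, (v i).2) := by
  simp [rho, Finset.smul_sum, mul_smul]

/-- The maps `ρ_n` taken together. -/
noncomputable def sigmaRho (X : Type*) (v : Σ n, Fin n → ℝ × X) : FreeDVS X := rho v.1 v.2

theorem surjective_sigmaRho : Function.Surjective (sigmaRho X) := by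
  intro v
  induction v using Finsupp.induction_linear with
  | zero => exact ⟨⟨0, Fin.elim0⟩, by simp [sigmaRho, rho]; rfl⟩
  | add v w hv hw =>
    obtain ⟨⟨m, v⟩, rfl⟩ := hv
    obtain ⟨⟨n, w⟩, rfl⟩ := hw
    exact ⟨⟨m + n, Fin.append v w⟩, rho_append v w⟩
  | single x r =>
    refine ⟨⟨1, fun _ ↦ (r, x)⟩, ?_⟩
    simp only [sigmaRho, rho, Fin.sum_univ_one, basisElem]
    exact Finsupp.smul_single_one x r

/-- The linear extension of a function on `X`. -/
noncomputable def lift (f : X → ℝ) : FreeDVS X →ₗ[ℝ] ℝ :=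
  Finsupp.linearCombination ℝ f

theorem lift_rho (f : X → ℝ) {n : ℕ} (v : Fin n → ℝ × X) :
    lift f (rho n v) = ∑ i, (v i).1 * f (v i).2 := by
  have h (x : X) : lift f (basisElem x) = f x :=
    (Finsupp.linearCombination_single ℝ 1 x).trans (one_smul ℝ _)
  simp [rho, h]

theorem eq_zero_of_forall_lift_eq_zero [TopologicalSpace X] [T2Space X] [LocallyCompactSpace X]
    (v : FreeDVS X) (hv : ∀ f : C(X, ℝ), lift f v = 0) : v = 0 := by
  classical
  let u : X →₀ ℝ := v
  change u = 0
  ext x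
  -- A function equal to `1` at `x` and `0` on the rest of the support reads off the coefficient at
  -- `x`.
  obtain ⟨f, hf1, hf0, -⟩ := exists_continuous_one_zero_of_isCompact (isCompact_singleton (x := x))
    (u.support.erase x).finite_toSet.isClosed (by simp)
  have h0 : Finsupp.linearCombination ℝ f u = 0 := hv f
  rw [Finsupp.linearCombination_apply, Finsupp.sum, Finset.sum_eq_single x] at h0
  · have : f x = 1 := hf1 rfl
    simpa [this] using h0
  · intro y hy hyx
    have : f y = 0 := hf0 (by simpa [hyx] using hy)
    simp [this]
  · intro hx
    simp [Finsupp.notMem_support_iff.1 hx]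

variable [DiffeologicalSpace X]

theorem dSmooth_rho (n : ℕ) : DSmooth (rho (X := X) n) := by
  intro m q hq
  -- `ρ_0` is not among the generators, but it is constant.
  rcases Nat.eq_zero_or_pos n with rfl | hn
  · have : rho 0 ∘ q = fun _ ↦ (0 : FreeDVS X) := by ext1; simp [rho]
    rw [this]
    exact isPlot_const
  · exact DiffeologicalSpace.isPlot_generatedFrom_of_mem ⟨n, hn, m, q, hq, rfl⟩

variable [TopologicalSpace X]

theorem hasOpenPlots_domain (hX : HasOpenPlots X) (n : ℕ) : HasOpenPlots (Fin n → ℝ × X) :=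
  .pi fun _ ↦ .prod .real hX

theorem dTopology_eq_coinduced (hX : HasOpenPlots X) :
    (dTopology : TopologicalSpace (FreeDVS X)) = .coinduced (sigmaRho X) inferInstance := by
  apply le_antisymm
  · intro U hU
    refine isOpen_iff_preimages_plots.2 fun n p hp ↦ ?_
    let _ : TopologicalSpace (FreeDVS X) := .coinduced (sigmaRho X) inferInstance
    -- Minimality of the generated diffeology reduces continuity of all plots to that of the
    -- generators.
    have hle : FreeDVS.diffeology X ≤ continuousDiffeology (FreeDVS X) := by
      refine DiffeologicalSpace.generateFrom_le_iff.2 ?_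
      rintro n p ⟨k, -, m, q, hq, h⟩
      obtain ⟨rfl, h⟩ := Sigma.mk.inj_iff.1 h
      obtain rfl := eq_of_heq h
      exact (continuous_coinduced_rng (f := sigmaRho X)).comp
        (continuous_sigmaMk.comp ((hasOpenPlots_domain hX k).continuous_of_isPlot hq))
    have hc : Continuous p := DiffeologicalSpace.le_iff'.1 hle n p hp
    exact hU.preimage hc
  · rw [← continuous_iff_coinduced_le]
    let _ : TopologicalSpace (FreeDVS X) := dTopology
    exact continuous_sigma fun n ↦ (hasOpenPlots_domain hX n).continuous_of_dSmooth (dSmooth_rho n)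

theorem isQuotientMap_sigmaRho (hX : HasOpenPlots X) :
    @IsQuotientMap _ _ _ dTopology (sigmaRho X) := by
  let _ : TopologicalSpace (FreeDVS X) := dTopology
  exact ⟨⟨dTopology_eq_coinduced hX⟩, surjective_sigmaRho⟩

theorem continuous_lift (hX : HasOpenPlots X) {f : X → ℝ} (hf : Continuous f) :
    @Continuous _ _ dTopology _ (lift f) := by
  let _ : TopologicalSpace (FreeDVS X) := dTopology
  refine (isQuotientMap_sigmaRho hX).continuous_iff.2 (continuous_sigma fun n ↦ ?_)
  exact (by fun_prop : Continuous fun v : Fin n → ℝ × X ↦ ∑ i, (v i).1 * f (v i).2).congr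
    fun v ↦ (lift_rho f v).symm

theorem t2Space [T2Space X] [LocallyCompactSpace X] (hX : HasOpenPlots X) :
    @T2Space (FreeDVS X) dTopology := by
  let _ : TopologicalSpace (FreeDVS X) := dTopology
  refine T2Space.of_injective_continuous (f := fun v (f : C(X, ℝ)) ↦ lift f v) ?_
    (continuous_pi fun f ↦ continuous_lift hX f.continuous)
  intro v w hvw
  refine sub_eq_zero.1 (eq_zero_of_forall_lift_eq_zero _ fun f ↦ ?_)
  rw [map_sub, sub_eq_zero]
  exact congrFun hvw f

theorem isQuotientMap_prodMap_sigmaRho [T2Space X] [LocallyCompactSpace X] [SigmaCompactSpace X]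
    (hX : HasOpenPlots X) :
    let _ : TopologicalSpace (FreeDVS X) := dTopology
    IsQuotientMap (Prod.map (sigmaRho X) (sigmaRho X)) := by
  let _ : TopologicalSpace (FreeDVS X) := dTopology
  have := t2Space hX
  have := weaklyLocallyCompactSpace_sigma (S := fun n ↦ Fin n → ℝ × X)
  exact (isQuotientMap_sigmaRho hX).prodMap_of_sigmaCompact (isQuotientMap_sigmaRho hX)

theorem isTVSUnderDTopology [T2Space X] [LocallyCompactSpace X] [SigmaCompactSpace X]
    (hX : HasOpenPlots X) : IsTVSUnderDTopology (FreeDVS X) := by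
  let _ : TopologicalSpace (FreeDVS X) := dTopology
  have hq := isQuotientMap_sigmaRho hX
  have hrho (n : ℕ) : Continuous (rho (X := X) n) :=
    hq.continuous.comp continuous_sigmaMk
  have hadd : ContinuousAdd (FreeDVS X) := by
    refine ⟨(isQuotientMap_prodMap_sigmaRho hX).continuous_iff.2
      (continuous_sigma_prod_sigma fun m n ↦ ?_)⟩
    refine ((hrho (m + n)).comp (g := rho (m + n))
      (f := fun p : (Fin m → ℝ × X) × (Fin n → ℝ × X) ↦ Fin.append p.1 p.2) ?_).congr
      fun p ↦ rho_append p.1 p.2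
    refine continuous_pi fun i ↦ ?_
    refine Fin.addCases (fun i ↦ ?_) (fun i ↦ ?_) i
    · simp only [Fin.append_left]
      fun_prop
    · simp only [Fin.append_right]
      fun_prop
  have hsmul : ContinuousSMul ℝ (FreeDVS X) := by
    -- Local compactness of `ℝ` suffices for this product with a quotient map.
    refine ⟨hq.continuous_lift_prod_right ?_⟩
    have hswap : Continuous fun p : (Σ n, Fin n → ℝ × X) × ℝ ↦ p.2 • sigmaRho X p.1 := by
      refine continuous_sigma_prod fun n ↦ ?_
      exact ((hrho n).comp (by fun_prop : Continuous fun p : (Fin n → ℝ × X) × ℝ ↦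
        fun i ↦ (p.2 * (p.1 i).1, (p.1 i).2))).congr fun p ↦ (smul_rho p.2 p.1).symm
    exact hswap.comp continuous_swap
  have hneg : ContinuousNeg (FreeDVS X) :=
    ⟨(continuous_const_smul (-1 : ℝ)).congr fun v ↦ by simp⟩
  exact ⟨{ }, hsmul⟩

/-- Smooth projections give one inequality. For the other, the product topology is coinduced from a
disjoint union of spaces with open plots, on which smooth maps are continuous. -/
theorem dTopology_prod [T2Space X] [LocallyCompactSpace X] [SigmaCompactSpace X]
    (hX : HasOpenPlots X) :
    (dTopology : TopologicalSpace (FreeDVS X × FreeDVS X)) =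
      @instTopologicalSpaceProd (FreeDVS X) (FreeDVS X) dTopology dTopology := by
  let _ : TopologicalSpace (FreeDVS X) := dTopology
  apply le_antisymm
  · have h₁ : DSmooth (Prod.fst : FreeDVS X × FreeDVS X → _) := fun _ _ hp ↦ hp.1
    have h₂ : DSmooth (Prod.snd : FreeDVS X × FreeDVS X → _) := fun _ _ hp ↦ hp.2
    exact le_inf (continuous_iff_le_induced.1 h₁.continuous)
      (continuous_iff_le_induced.1 h₂.continuous)
  · have h : @Continuous _ _ _ dTopology (Prod.map (sigmaRho X) (sigmaRho X)) := by
      let _ : TopologicalSpace (FreeDVS X × FreeDVS X) := dTopology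
      refine continuous_sigma_prod_sigma fun m n ↦ ?_
      refine ((hasOpenPlots_domain hX m).prod (hasOpenPlots_domain hX n)).continuous_of_dSmooth ?_
      exact fun k p hp ↦ ⟨dSmooth_rho m _ _ hp.1, dSmooth_rho n _ _ hp.2⟩
    rw [(isQuotientMap_prodMap_sigmaRho hX).eq_coinduced]
    exact continuous_iff_coinduced_le.1 h

end FreeDVS

theorem mainTheorem7 (d : ℕ) (M : Type*) [TopologicalSpace M]
    [ChartedSpace (EuclideanSpace ℝ (Fin d)) M] [IsManifold (𝓡 d) ∞ M]
    [T2Space M] [SecondCountableTopology M] :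
    letI : DiffeologicalSpace M := manifoldDiffeology (𝓡 d) M
    IsTVSUnderDTopology (FreeDVS M) ∧
      (dTopology : TopologicalSpace (FreeDVS M × FreeDVS M)) =
        @instTopologicalSpaceProd (FreeDVS M) (FreeDVS M) dTopology dTopology := by
  let _ : DiffeologicalSpace M := manifoldDiffeology (𝓡 d) M
  have : LocallyCompactSpace M := ChartedSpace.locallyCompactSpace (EuclideanSpace ℝ (Fin d)) M
  have hM : HasOpenPlots M := .manifold d M
  exact ⟨FreeDVS.isTVSUnderDTopology hM, FreeDVS.dTopology_prod hM⟩
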